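/- Let $G$ be an infinite Hausdorff topological group which is - Boolean, i.e. $x^2=e$ for every $x\in G$, where $e$ is the identity of $G$ (in particular, $G$ is abelian); - pseudocompact, i.e. every continuous function $f\colon G\to\mathbb{R}$ is bounded; and - self-dual, i.e. $G$ is topologically isomorphic to its Pontryagin dual $\widehat{G}$, the group of all continuous homomorphisms from $G$ to the circle group $\mathbb{T}$ endowed with the compact-open topology. Then $G$ is not selectively pseudocompact. Here, a topological space $X$ is called selectively pseudocompact if for every sequence $(U_n)_{n\in\mathbb{N}}$ of non-empty open subsets of $X$ one can choose points $x_n\in U_n$ $(n\in\mathbb{N})$ such that the sequence $(x_n)_{n\in\mathbb{N}}$ has an accumulation point in $X$, i.e. there is a point $x\in X$ such that for every neighbourhood $V$ of $x$ the set $\{n\in\mathbb{N}: x_n\in V\}$ is infinite. -/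

import Mathlib

/-- A topological space is pseudocompact if every continuous real-valued function on it is bounded.
(The Tychonoff separation usually included in this notion holds for all Hausdorff groups.) -/
def IsPseudocompact (X : Type*) [TopologicalSpace X] : Prop :=
  ∀ f : X → ℝ, Continuous f → Bornology.IsBounded (Set.range f)

/-- A topological space is selectively pseudocompact if for every sequence of non-empty open sets
`U n` one can select points `x n ∈ U n` so that the sequence `x` has an accumulation point `a`,
i.e. every neighbourhood of `a` contains `x n` for infinitely many `n`. -/
def IsSelectivelyPseudocompact (X : Type*) [TopologicalSpace X] : Prop :=
  ∀ U : ℕ → Set X, (∀ n, IsOpen (U n)) → (∀ n, (U n).Nonempty) →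
    ∃ x : ℕ → X, (∀ n, x n ∈ U n) ∧ ∃ a : X, ∀ V ∈ nhds a, {n : ℕ | x n ∈ V}.Infinite

/-- A group is Boolean if `x ^ 2 = 1` for all `x`; such a group is abelian. -/
def IsBooleanGroup (G : Type*) [Group G] : Prop :=
  ∀ x : G, x ^ 2 = 1

/-- A topological group is self-dual if it is topologically isomorphic to its Pontryagin dual (the
group of continuous characters, with the compact-open topology). The dual is an abelian group, so a
self-dual group is automatically abelian. -/
def IsSelfDual (G : Type*) [Group G] [TopologicalSpace G] : Prop :=
  Nonempty (G ≃ₜ* PontryaginDual G)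

open Topology Filter

/-! Self-duality makes `G`, as a vector space over the two-element field, carry an injective,
separately continuous bilinear pairing with itself. Finitely many independent functionals take any
prescribed values, and pseudocompactness extends this to countably many, so some `g` separates any
given point from all but finitely many terms of an independent sequence. Such a sequence thus has no
accumulation point. Yet suitable open sets force every selection from them to be independent. -/

/-- On a pseudocompact space, a sequence of equations between locally constant functions is
solvable as soon as each of its finite initial segments is. -/
theorem IsPseudocompact.exists_forall_eq {X α : Type*} [TopologicalSpace X]
    (hX : IsPseudocompact X) {f : ℕ → X → α} (hf : ∀ i, IsLocallyConstant (f i)) (c : ℕ → α)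
    (hfin : ∀ n : ℕ, ∃ x, ∀ i < n, f i x = c i) : ∃ x, ∀ i, f i x = c i := by
  classical
  by_contra! H
  -- The first failing index depends only on finitely many of the `f i`; by `hfin` it is unbounded.
  have hN : IsLocallyConstant fun x => Nat.find (H x) := by
    rw [IsLocallyConstant.iff_eventually_eq]
    intro x
    have hev : ∀ᶠ y in 𝓝 x, ∀ i ∈ Finset.range (Nat.find (H x) + 1), f i y = f i x :=
      (Finset.eventually_all _).2 fun i _ =>
        (IsLocallyConstant.iff_eventually_eq (f i)).1 (hf i) x
    filter_upwards [hev] with y hy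
    rw [Nat.find_eq_iff]
    refine ⟨?_, fun i hi => ?_⟩
    · rw [hy _ (by simp)]
      exact Nat.find_spec (H x)
    · rw [hy i (Finset.mem_range.2 (hi.trans (Nat.lt_succ_self _)))]
      exact Nat.find_min (H x) hi
  have hcont : Continuous fun x => (Nat.find (H x) : ℝ) :=
    (hN.comp (fun n : ℕ => (n : ℝ))).continuous
  obtain ⟨C, hC⟩ := (hX _ hcont).bddAbove
  obtain ⟨n, hn⟩ := exists_nat_gt C
  obtain ⟨x, hx⟩ := hfin n
  have h1 : (Nat.find (H x) : ℝ) ≤ C := hC ⟨x, rfl⟩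
  have h2 : n ≤ Nat.find (H x) := by
    rw [Nat.le_find_iff]
    intro i hi
    simpa using hx i hi
  have h3 : (n : ℝ) ≤ Nat.find (H x) := by exact_mod_cast h2
  linarith

/-- Finitely many linearly independent functionals take arbitrary prescribed values. -/
theorem LinearIndependent.exists_dual_apply_eq {K V ι : Type*} [Field K] [AddCommGroup V]
    [Module K V] [Finite ι] {f : ι → Module.Dual K V} (hf : LinearIndependent K f) (c : ι → K) :
    ∃ v, ∀ i, f i v = c i := by
  classical
  have := Fintype.ofFinite ι
  suffices h : LinearMap.range (LinearMap.pi f) = ⊤ by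
    obtain ⟨v, hv⟩ := LinearMap.range_eq_top.1 h c
    exact ⟨v, fun i => congrFun hv i⟩
  by_contra h
  obtain ⟨φ, hφ, hle⟩ := Submodule.exists_le_ker_of_lt_top _ (lt_top_iff_ne_top.2 h)
  apply hφ
  -- A functional vanishing on the range is a linear relation among the `f i`.
  have key : ∑ i, φ (Pi.single i 1) • f i = 0 := by
    ext v
    have hv : φ (LinearMap.pi f v) = 0 := hle ⟨v, rfl⟩
    rw [LinearMap.pi_apply_eq_sum_univ φ] at hv
    have hsingle : ∀ i : ι, (fun j => if i = j then (1 : K) else 0) = Pi.single i 1 := fun i => by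
      ext j
      simp [Pi.single_apply, eq_comm (a := i)]
    simpa [hsingle, mul_comm] using hv
  have hz := Fintype.linearIndependent_iff.1 hf _ key
  ext i
  simpa using hz i

theorem exists_linearIndependent_nat {K V : Type*} [Field K] [Finite K] [AddCommGroup V]
    [Module K V] [Infinite V] : ∃ v : ℕ → V, LinearIndependent K v := by
  let b := Module.Basis.ofVectorSpace K V
  have : Infinite (Module.Basis.ofVectorSpaceIndex K V) := by
    by_contra h
    rw [not_infinite_iff_finite] at h
    have : Module.Finite K V := Module.Finite.of_basis b
    have : Finite V := Module.finite_of_finite K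
    exact not_finite V
  exact ⟨_, b.linearIndependent.comp _ (Infinite.natEmbedding _).injective⟩

section Pairing

variable {K V : Type*} [Field K] [AddCommGroup V] [Module K V] [TopologicalSpace V]
  {β : V →ₗ[K] Module.Dual K V}

/-- Given an injective pairing on a pseudocompact space, every function on a countable linearly
independent family is induced by pairing with some vector. -/
theorem LinearIndependent.exists_pairing_eq (hV : IsPseudocompact V) (hβ : Function.Injective β)
    (hr : ∀ x, IsLocallyConstant (β x)) {ι : Type*} [Countable ι] [Infinite ι] {x : ι → V}
    (hx : LinearIndependent K x) (c : ι → K) : ∃ g, ∀ i, β (x i) g = c i := by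
  obtain ⟨e⟩ := nonempty_equiv_of_countable (α := ℕ) (β := ι)
  have hf : LinearIndependent K fun n => β (x (e n)) :=
    (hx.comp e e.injective).map' β (LinearMap.ker_eq_bot.2 hβ)
  obtain ⟨g, hg⟩ := hV.exists_forall_eq (fun n => hr (x (e n))) (fun n => c (e n)) fun n => by
    obtain ⟨v, hv⟩ := (hf.comp (fun i : Fin n => (i : ℕ)) Fin.val_injective).exists_dual_apply_eq
      fun i => c (e i)
    exact ⟨v, fun i hi => hv ⟨i, hi⟩⟩
  exact ⟨g, fun i => by simpa using hg (e.symm i)⟩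

/-- Under a separately continuous injective pairing on a pseudocompact space, linearly independent
sequences have no accumulation points. -/
theorem LinearIndependent.exists_nhds_finite (hV : IsPseudocompact V) (hβ : Function.Injective β)
    (hl : ∀ y, IsLocallyConstant fun x => β x y) (hr : ∀ x, IsLocallyConstant (β x))
    {x : ℕ → V} (hx : LinearIndependent K x) (a : V) :
    ∃ W ∈ 𝓝 a, {n | x n ∈ W}.Finite := by
  classical
  suffices h : ∃ g, {n | β (x n) g = β a g}.Finite by
    obtain ⟨g, hg⟩ := h
    exact ⟨{y | β y g = β a g}, (IsLocallyConstant.iff_eventually_eq _).1 (hl g) a, hg⟩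
  by_cases ha : a ∈ Submodule.span K (Set.range x)
  · obtain ⟨l, rfl⟩ := Finsupp.mem_span_range_iff_exists_finsupp.1 ha
    by_cases h0 : l = 0
    · obtain ⟨g, hg⟩ := hx.exists_pairing_eq hV hβ hr fun _ => 1
      exact ⟨g, by simp [h0, hg]⟩
    · obtain ⟨i, hi⟩ := Finsupp.ne_iff.1 h0
      -- This `g` reads off the coefficient at `i`: `l i ≠ 0` for `a`, and zero for every `x n` with
      -- `n ≠ i`.
      obtain ⟨g, hg⟩ := hx.exists_pairing_eq hV hβ hr (Pi.single i 1)
      have hlg : β (l.sum fun j k => k • x j) g = l i := by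
        simpa [Finsupp.sum, hg, Pi.single_apply] using Eq.symm
      refine ⟨g, (Set.finite_singleton i).subset fun n hn => ?_⟩
      by_contra hne
      rw [Set.mem_ofPred_eq, hlg, hg, Pi.single_eq_of_ne hne] at hn
      exact hi hn.symm
  · have hy : LinearIndependent K fun o : Option ℕ => o.elim a x :=
      linearIndependent_option.2 ⟨hx, ha⟩
    obtain ⟨g, hg⟩ := hy.exists_pairing_eq hV hβ hr fun o => o.elim 1 fun _ => 0
    have hga : β a g = 1 := hg none
    have hgx : ∀ n, β (x n) g = 0 := fun n => hg (some n)
    exact ⟨g, by simp [hga, hgx]⟩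

/-- An infinite vector space over a finite field with a separately continuous injective pairing is
not both pseudocompact and selectively pseudocompact. -/
theorem not_isSelectivelyPseudocompact_of_pairing [Finite K] [Infinite V]
    (hV : IsPseudocompact V) (hβ : Function.Injective β)
    (hl : ∀ y, IsLocallyConstant fun x => β x y) (hr : ∀ x, IsLocallyConstant (β x)) :
    ¬ IsSelectivelyPseudocompact V := by
  intro hsel
  obtain ⟨v, hv⟩ := exists_linearIndependent_nat (K := K) (V := V)
  -- Triangular conditions: only finitely many per `n`, so `U n` is open.
  let U : ℕ → Set V := fun n => {y | ∀ i ≤ n, β (v i) y = if i = n then 1 else 0}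
  have hUo : ∀ n, IsOpen (U n) := fun n => by
    have : U n = ⋂ i ∈ Set.Iic n, β (v i) ⁻¹' {if i = n then 1 else 0} := by
      ext y; simp [U]
    rw [this]
    exact (Set.finite_Iic n).isOpen_biInter fun i _ => hr (v i) _
  have hUne : ∀ n, (U n).Nonempty := fun n => by
    obtain ⟨g, hg⟩ := hv.exists_pairing_eq hV hβ hr fun i => if i = n then 1 else 0
    exact ⟨g, fun i _ => hg i⟩
  obtain ⟨x, hxU, a, ha⟩ := hsel U hUo hUne
  have hx : LinearIndependent K x := by
    rw [linearIndependent_iff]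
    intro l hl0
    by_contra hne
    have hs := Finsupp.support_nonempty_iff.2 hne
    -- Pairing with `v m` kills each `x j` with `j > m`, leaving only the coefficient `l m`.
    set m := l.support.min' hs
    have hm : m ∈ l.support := l.support.min'_mem hs
    have h := congrArg (β (v m)) hl0
    rw [Finsupp.linearCombination_apply, Finsupp.sum, map_sum, map_zero,
      Finset.sum_eq_single m] at h
    · rw [map_smul, hxU m m le_rfl] at h
      simp at h
      exact Finsupp.mem_support_iff.1 hm h
    · intro j hj hjm
      rw [map_smul, hxU j m (l.support.min'_le j hj), if_neg (Ne.symm hjm), smul_zero]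
    · exact fun h => (h hm).elim
  obtain ⟨W, hW, hfin⟩ := hx.exists_nhds_finite hV hβ hl hr a
  exact ha W hW hfin

end Pairing

namespace Circle

open Classical in
/-- The additive sign of a point of the circle: `0` at `1`, and `1` elsewhere. It is additive on the
square roots of `1`. -/
noncomputable def parity (z : Circle) : ZMod 2 := if z = 1 then 0 else 1

@[simp] theorem parity_one : parity 1 = 0 := if_pos rfl

theorem parity_eq_zero_iff {z : Circle} : parity z = 0 ↔ z = 1 := by
  by_cases h : z = 1 <;> simp [parity, h]

theorem eq_one_or_eq_neg_one {z : Circle} (hz : z ^ 2 = 1) : z = 1 ∨ z = -1 := by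
  have h : (z : ℂ) ^ 2 = 1 := by exact_mod_cast congrArg ((↑) : Circle → ℂ) hz
  rcases mul_self_eq_one_iff.1 ((sq (z : ℂ)).symm.trans h) with h | h
  · exact Or.inl (Circle.ext (by simpa using h))
  · exact Or.inr (Circle.ext (by simpa using h))

theorem neg_one_ne_one : (-1 : Circle) ≠ 1 := by
  intro h
  have h' := congrArg ((↑) : Circle → ℂ) h
  norm_num at h'

theorem parity_mul {z w : Circle} (hz : z ^ 2 = 1) (hw : w ^ 2 = 1) :
    parity (z * w) = parity z + parity w := by
  rcases eq_one_or_eq_neg_one hz with rfl | rfl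
  · simp
  · rcases eq_one_or_eq_neg_one hw with rfl | rfl
    · simp
    · have h : parity (-1) = 1 := if_neg neg_one_ne_one
      simp only [neg_mul_neg, mul_one, parity_one, h]
      decide

theorem isLocallyConstant_parity_comp {X : Type*} [TopologicalSpace X] {f : X → Circle}
    (hf : Continuous f) (hsq : ∀ x, f x ^ 2 = 1) : IsLocallyConstant fun x => parity (f x) := by
  rw [IsLocallyConstant.iff_eventually_eq]
  intro x
  rcases eq_one_or_eq_neg_one (hsq x) with hx | hx
  · filter_upwards [hf.continuousAt.eventually_ne (hx ▸ neg_one_ne_one.symm : f x ≠ -1)] with y hy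
    rw [hx, (eq_one_or_eq_neg_one (hsq y)).resolve_right hy]
  · filter_upwards [hf.continuousAt.eventually_ne (hx ▸ neg_one_ne_one : f x ≠ 1)] with y hy
    rw [hx, (eq_one_or_eq_neg_one (hsq y)).resolve_left hy]

end Circle

theorem PontryaginDual.continuous_eval {A : Type*} [Monoid A] [TopologicalSpace A] (a : A) :
    Continuous fun χ : PontryaginDual A => χ a :=
  continuous_eval_const (F := A →ₜ* Circle) a

theorem IsBooleanGroup.character_sq {G : Type*} [Group G] [TopologicalSpace G]
    (hG : IsBooleanGroup G) (χ : PontryaginDual G) (y : G) : χ y ^ 2 = 1 := by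
  rw [← map_pow, hG, map_one]

theorem corollary5p4 {G : Type*} [Group G] [TopologicalSpace G] [IsTopologicalGroup G]
    [T2Space G] [Infinite G] (hBool : IsBooleanGroup G) (hpc : IsPseudocompact G)
    (hdual : IsSelfDual G) : ¬ IsSelectivelyPseudocompact G := by
  obtain ⟨φ⟩ := hdual
  have hcomm : ∀ x y : G, x * y = y * x := fun x y =>
    φ.injective (by rw [map_mul, map_mul, mul_comm])
  let : AddCommGroup (Additive G) :=
    { (inferInstance : AddGroup (Additive G)) with add_comm := hcomm }
  let : Module (ZMod 2) (Additive G) := AddCommGroup.zmodModule fun x => hBool x.toMul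
  have hsq : ∀ x y : G, φ x y ^ 2 = 1 := fun x y => hBool.character_sq (φ x) y
  let β₀ : Additive G →+ Additive G →+ ZMod 2 :=
    AddMonoidHom.mk' (fun x => AddMonoidHom.mk' (fun y => Circle.parity (φ x.toMul y.toMul))
      fun y z => by
        rw [toMul_add, map_mul, Circle.parity_mul (hsq _ _) (hsq _ _)])
      fun x z => by
        refine AddMonoidHom.ext fun y => ?_
        change Circle.parity (φ (x.toMul * z.toMul) y.toMul) = _
        rw [map_mul]
        exact Circle.parity_mul (hsq _ _) (hsq _ _)
  let β : Additive G →ₗ[ZMod 2] Module.Dual (ZMod 2) (Additive G) :=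
    ((AddMonoidHom.toZModLinearMapEquiv 2).toAddMonoidHom.comp β₀).toZModLinearMap 2
  have hinj : Function.Injective β := by
    rw [injective_iff_map_eq_zero]
    intro x hx
    have : φ x.toMul = 1 := by
      ext y : 1
      exact Circle.parity_eq_zero_iff.1 (LinearMap.congr_fun hx (Additive.ofMul y))
    exact φ.injective (this.trans (map_one φ).symm)
  refine not_isSelectivelyPseudocompact_of_pairing (K := ZMod 2) (V := Additive G) (β := β)
    hpc hinj (fun y => ?_) fun x => ?_
  · exact Circle.isLocallyConstant_parity_comp (X := G)
      ((PontryaginDual.continuous_eval (Additive.toMul y)).comp φ.continuous) fun x => hsq x _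
  · exact Circle.isLocallyConstant_parity_comp (X := G) (map_continuous (φ (Additive.toMul x))) (hsq _)
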